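/- Let $C^\infty(S^1,\mathbb R^2)$ be the Fréchet space of smooth maps $c:S^1\to\mathbb R^2=\mathbb C$, viewed as smooth $2\pi$-periodic functions of $\theta\in\mathbb R$, with the $C^\infty$-topology (uniform convergence of every derivative). Let $\mathrm{Imm}^0(S^1,\mathbb R^2)$ be the subspace of all immersions of rotation degree $0$, that is, of all $c$ such that $c'(\theta)\neq 0$ for every $\theta$ and the winding number of $c'$ around $0$ is $0$; equivalently, $c'(\theta)/|c'(\theta)|=\exp(i\,a(\theta))$ for some smooth $2\pi$-periodic function $a:\mathbb R\to\mathbb R$. Then the topological space $\mathrm{Imm}^0(S^1,\mathbb R^2)$ is homotopy equivalent to the circle $S^1$. -/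

import Mathlib

open scoped ContDiff

namespace PlaneCurve

/-- Smooth closed plane curves `S¹ → ℝ² = ℂ`, viewed as smooth `2π`-periodic functions of the
real variable `θ`. This is the space `C^∞(S¹, ℝ²)`. -/
structure SmoothLoop where
  toFun : ℝ → ℂ
  contDiff : ContDiff ℝ ∞ toFun
  periodic : Function.Periodic toFun (2 * Real.pi)

namespace SmoothLoop

/-- The `n`-th derivative of a smooth closed curve, as a continuous map. -/
noncomputable def derivMap (n : ℕ) (c : SmoothLoop) : C(ℝ, ℂ) where
  toFun := iteratedDeriv n c.toFun
  continuous_toFun := c.contDiff.continuous_iteratedDeriv n (by exact_mod_cast le_top)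

/-- The Fréchet `C^∞`-topology: the coarsest topology for which all the maps `c ↦ c⁽ⁿ⁾` into
`C(ℝ, ℂ)`, with locally uniform convergence (the compact-open topology), are continuous.
By periodicity this is uniform convergence of every derivative on the circle. -/
noncomputable instance : TopologicalSpace SmoothLoop :=
  ⨅ n : ℕ, TopologicalSpace.induced (derivMap n) inferInstance

/-- The curve is an immersion. -/
def IsImmersion (c : SmoothLoop) : Prop := ∀ θ : ℝ, deriv c.toFun θ ≠ 0

/-- `a : ℝ → ℝ` is an argument of the curve `c`: it is smooth and
`c'(θ) / |c'(θ)| = exp (i a(θ))`. -/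
def IsArgument (c : SmoothLoop) (a : ℝ → ℝ) : Prop :=
  ContDiff ℝ ∞ a ∧
    ∀ θ : ℝ, deriv c.toFun θ / (‖deriv c.toFun θ‖ : ℂ) = Complex.exp (Complex.I * (a θ : ℂ))

/-- The immersion `c` has rotation degree `k`, i.e. `c'` has winding number `k` around `0`:
some argument of `c` increases by `2πk` over each period. (Two arguments differ by a constant,
so "some" and "any" agree.) -/
def HasRotationDegree (c : SmoothLoop) (k : ℤ) : Prop :=
  ∃ a : ℝ → ℝ, c.IsArgument a ∧ ∀ θ : ℝ, a (θ + 2 * Real.pi) - a θ = 2 * (k : ℝ) * Real.pi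

end SmoothLoop

/-- `Imm^k(S¹, ℝ²)`: the immersions of rotation degree `k`, with the subspace topology of
`C^∞(S¹, ℝ²)`. -/
def Imm (k : ℤ) : Set SmoothLoop := {c | c.IsImmersion ∧ c.HasRotationDegree k}

end PlaneCurve

/-!
An immersion `c` of rotation degree `0` is determined by its starting point, its initial direction
`z`, its speed `r > 0` and its turning angle `β`, a periodic function with `β 0 = 0`: one has
`c' = z r exp (iβ)`. The pairs `(r, β)` which occur are those satisfying the closing condition
`∫ r exp (iβ) = 0` over a period (`IsTangent`). All these data depend continuously on `c`, so it is
enough to contract the space of pairs `(r, β)`; the initial direction is then a homotopy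
equivalence to the circle, with inverse the rotations of one fixed curve.

The contraction is easy if densities are only required to be nonnegative. Reparametrise the curve
by a homotopy from the identity to a monotone map of degree one which is constant on half of the
circle (`collapse`). The density then vanishes on that half, so a figure eight can be inserted
there: first add its angle function, which leaves `r exp (iβ)` unchanged, then move the density
linearly to that of the figure eight, and finally scale the angle of the original curve to `0` where
it is no longer seen. The closing condition holds throughout because each density only sees its own
angle function (`moment_deform`).

Positivity of the density is restored by an explicit continuous correction, `posDensity`. It adds a
constant to a nonnegative closed density `u` and compensates the closing defect by multiplying `u`
by an affine function of `cos β` and `sin β`. The compensation solves a linear system with matrix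
the Gram matrix of `cos β` and `sin β` with respect to `u`, whose determinant stays positive
throughout the deformation (`IsWeakTangent`). Solving by the adjugate keeps the formula polynomial
in integrals of the data. The density of a closed immersion is joined to its correction by a
segment, since for given `β` the positive closed densities form a convex set.

Continuity into the Fréchet space amounts to joint continuity of all derivatives in the parameter
and the curve variable (`IsSmoothFamily`), a property stable under the operations used above.
-/

namespace PlaneCurve

open Function

/-! ### Families of smooth curves -/

section Families

variable {X Y : Type*} [TopologicalSpace X] [TopologicalSpace Y]
variable {E F G : Type} [NormedAddCommGroup E] [NormedSpace ℝ E] [NormedAddCommGroup F]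
  [NormedSpace ℝ F] [NormedAddCommGroup G] [NormedSpace ℝ G]

/-- A family `f x : ℝ → E` of curves parametrised by a topological space `X` is of class `C^n`
along the curves: each `f x` is `n` times differentiable and all derivatives in the curve variable
up to order `n` are continuous in both variables jointly. No regularity beyond continuity is asked
for in the parameter. -/
def IsCkFamily : ℕ → (X → ℝ → E) → Prop
  | 0, f => Continuous (uncurry f)
  | n + 1, f => Continuous (uncurry f) ∧ (∀ x, Differentiable ℝ (f x)) ∧
      IsCkFamily n (fun x => deriv (f x))

/-- A family of smooth curves all of whose derivatives are jointly continuous. For families of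
smooth loops this is continuity into the Fréchet space, see
`SmoothLoop.isSmoothFamily_toFun` and `SmoothLoop.continuous_of_isSmoothFamily`. -/
def IsSmoothFamily (f : X → ℝ → E) : Prop := ∀ n, IsCkFamily n f

namespace IsCkFamily

theorem continuous {n : ℕ} {f : X → ℝ → E} (h : IsCkFamily n f) : Continuous (uncurry f) := by
  cases n with
  | zero => exact h
  | succ n => exact h.1

theorem of_succ {n : ℕ} {f : X → ℝ → E} (h : IsCkFamily (n + 1) f) : IsCkFamily n f := by
  induction n generalizing f with
  | zero => exact h.1
  | succ n ih => exact ⟨h.1, h.2.1, ih h.2.2⟩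

theorem succ {n : ℕ} {f f' : X → ℝ → E} (hc : Continuous (uncurry f))
    (hd : ∀ x θ, HasDerivAt (f x) (f' x θ) θ) (h : IsCkFamily n f') : IsCkFamily (n + 1) f := by
  have : (fun x => deriv (f x)) = f' := by
    ext x θ; exact (hd x θ).deriv
  exact ⟨hc, fun x θ => (hd x θ).differentiableAt, this ▸ h⟩

theorem add {n : ℕ} {f g : X → ℝ → E} (hf : IsCkFamily n f) (hg : IsCkFamily n g) :
    IsCkFamily n (fun x θ => f x θ + g x θ) := by
  induction n generalizing f g with
  | zero => exact Continuous.add hf hg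
  | succ n ih =>
    exact succ (hf.continuous.add hg.continuous)
      (fun x θ => ((hf.2.1 x θ).hasDerivAt).add ((hg.2.1 x θ).hasDerivAt)) (ih hf.2.2 hg.2.2)

theorem bilin {n : ℕ} (B : E →L[ℝ] F →L[ℝ] G) {f : X → ℝ → E} {g : X → ℝ → F}
    (hf : IsCkFamily n f) (hg : IsCkFamily n g) : IsCkFamily n (fun x θ => B (f x θ) (g x θ)) := by
  have cont : ∀ {f : X → ℝ → E} {g : X → ℝ → F}, Continuous (uncurry f) → Continuous (uncurry g) →
      Continuous (uncurry fun x θ => B (f x θ) (g x θ)) := fun hf hg =>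
    (B.continuous.comp hf).clm_apply hg
  induction n generalizing f g with
  | zero => exact cont hf hg
  | succ n ih =>
    refine succ (cont hf.continuous hg.continuous) (fun x θ => ?_)
      ((ih hf.of_succ hg.2.2).add (ih hf.2.2 hg.of_succ))
    exact B.hasDerivAt_of_bilinear (fun _ => (hf.2.1 x θ).hasDerivAt)
      (fun _ => (hg.2.1 x θ).hasDerivAt)

theorem contDiffOn_comp {n : ℕ} {s : Set E} (hs : IsOpen s) {g : E → F} (hg : ContDiffOn ℝ ∞ g s)
    {f : X → ℝ → E} (hf : IsCkFamily n f) (hfs : ∀ x θ, f x θ ∈ s) :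
    IsCkFamily n (fun x θ => g (f x θ)) := by
  induction n generalizing F g with
  | zero => exact hg.continuousOn.comp_continuous hf fun p => hfs p.1 p.2
  | succ n ih =>
    -- The derivative of `g ∘ f` is the evaluation of `fderiv g ∘ f` on `f'`, a bilinear expression;
    -- the induction hypothesis applies to `fderiv g`, with another target space.
    refine succ (hg.continuousOn.comp_continuous hf.continuous fun p => hfs p.1 p.2)
      (fun x θ => ?_) (bilin (ContinuousLinearMap.id ℝ (E →L[ℝ] F))
        (ih (hg.fderiv_of_isOpen hs (m := ∞) (by simp)) hf.of_succ) hf.2.2)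
    exact (((hg.contDiffAt (hs.mem_nhds (hfs x θ))).differentiableAt
      (by simp)).hasFDerivAt).comp_hasDerivAt θ (hf.2.1 x θ).hasDerivAt

theorem reparam {n : ℕ} {f : X → ℝ → E} {φ : X → ℝ → ℝ} (hf : IsCkFamily n f)
    (hφ : IsCkFamily n φ) : IsCkFamily n (fun x θ => f x (φ x θ)) := by
  have cont : ∀ {f : X → ℝ → E}, Continuous (uncurry f) → Continuous (uncurry φ) →
      Continuous (uncurry fun x θ => f x (φ x θ)) := fun hf hφ =>
    hf.comp (continuous_fst.prodMk hφ)
  induction n generalizing f with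
  | zero => exact cont hf hφ
  | succ n ih =>
    refine succ (cont hf.continuous hφ.continuous) (fun x θ => ?_)
      (bilin (ContinuousLinearMap.lsmul ℝ ℝ) hφ.2.2 (ih hf.2.2 hφ.of_succ))
    exact ((hf.2.1 x _).hasDerivAt).scomp θ (hφ.2.1 x θ).hasDerivAt

theorem const {n : ℕ} {h : X → E} (hh : Continuous h) : IsCkFamily n (fun x (_ : ℝ) => h x) := by
  induction n generalizing h with
  | zero => exact hh.comp continuous_fst
  | succ n ih =>
    exact succ (hh.comp continuous_fst) (fun x θ => hasDerivAt_const θ (h x))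
      (ih (h := fun _ => 0) continuous_const)

theorem comp_continuous {n : ℕ} {f : X → ℝ → E} (hf : IsCkFamily n f) {k : Y → X}
    (hk : Continuous k) : IsCkFamily n (fun y => f (k y)) := by
  induction n generalizing f with
  | zero => exact Continuous.comp hf (hk.prodMap continuous_id)
  | succ n ih =>
    exact ⟨Continuous.comp hf.1 (hk.prodMap continuous_id), fun y => hf.2.1 _, ih hf.2.2⟩

theorem iff_iteratedDeriv {n : ℕ} {f : X → ℝ → E} (hf : ∀ x, ContDiff ℝ ∞ (f x)) :
    IsCkFamily n f ↔ ∀ m ≤ n, Continuous (uncurry fun x => iteratedDeriv m (f x)) := by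
  induction n generalizing f with
  | zero => simp [IsCkFamily]
  | succ n ih =>
    have hd : ∀ x, ContDiff ℝ ∞ (deriv (f x)) := fun x =>
      ((contDiff_infty_iff_deriv).1 (hf x)).2
    simp only [IsCkFamily, ih hd, ← iteratedDeriv_succ']
    constructor
    · rintro ⟨h0, -, h⟩ m hm
      cases m with
      | zero => simpa using h0
      | succ m => exact h m (by omega)
    · intro h
      exact ⟨by simpa using h 0 (by omega), fun x => (hf x).differentiable (by simp),
        fun m hm => h (m + 1) (by omega)⟩

end IsCkFamily

namespace IsSmoothFamily

theorem continuous {f : X → ℝ → E} (h : IsSmoothFamily f) : Continuous (uncurry f) := h 0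

theorem differentiable {f : X → ℝ → E} (h : IsSmoothFamily f) (x : X) : Differentiable ℝ (f x) :=
  (h 1).2.1 x

theorem deriv {f : X → ℝ → E} (h : IsSmoothFamily f) : IsSmoothFamily fun x => deriv (f x) :=
  fun n => (h (n + 1)).2.2

theorem contDiff {f : X → ℝ → E} (h : IsSmoothFamily f) (x : X) : ContDiff ℝ ∞ (f x) := by
  refine contDiff_infty.2 fun n => ?_
  induction n generalizing f with
  | zero => exact contDiff_zero.2 (h.continuous.comp (Continuous.prodMk_right x))
  | succ n ih =>
    exact_mod_cast contDiff_succ_iff_deriv.2 ⟨h.differentiable x, by simp, ih h.deriv⟩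

theorem add {f g : X → ℝ → E} (hf : IsSmoothFamily f) (hg : IsSmoothFamily g) :
    IsSmoothFamily fun x θ => f x θ + g x θ := fun n => (hf n).add (hg n)

theorem bilin (B : E →L[ℝ] F →L[ℝ] G) {f : X → ℝ → E} {g : X → ℝ → F} (hf : IsSmoothFamily f)
    (hg : IsSmoothFamily g) : IsSmoothFamily fun x θ => B (f x θ) (g x θ) :=
  fun n => (hf n).bilin B (hg n)

theorem mul {A : Type} [NormedRing A] [NormedAlgebra ℝ A] {f g : X → ℝ → A}
    (hf : IsSmoothFamily f) (hg : IsSmoothFamily g) : IsSmoothFamily fun x θ => f x θ * g x θ :=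
  hf.bilin (ContinuousLinearMap.mul ℝ A) hg

theorem contDiffOn_comp {s : Set E} (hs : IsOpen s) {g : E → F} (hg : ContDiffOn ℝ ∞ g s)
    {f : X → ℝ → E} (hf : IsSmoothFamily f) (hfs : ∀ x θ, f x θ ∈ s) :
    IsSmoothFamily fun x θ => g (f x θ) := fun n => (hf n).contDiffOn_comp hs hg hfs

theorem contDiff_comp {g : E → F} (hg : ContDiff ℝ ∞ g) {f : X → ℝ → E} (hf : IsSmoothFamily f) :
    IsSmoothFamily fun x θ => g (f x θ) :=
  hf.contDiffOn_comp isOpen_univ hg.contDiffOn fun _ _ => Set.mem_univ _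

theorem reparam {f : X → ℝ → E} {φ : X → ℝ → ℝ} (hf : IsSmoothFamily f)
    (hφ : IsSmoothFamily φ) : IsSmoothFamily fun x θ => f x (φ x θ) :=
  fun n => (hf n).reparam (hφ n)

theorem const {h : X → E} (hh : Continuous h) : IsSmoothFamily fun x (_ : ℝ) => h x :=
  fun _ => .const hh

theorem comp_continuous {f : X → ℝ → E} (hf : IsSmoothFamily f) {k : Y → X} (hk : Continuous k) :
    IsSmoothFamily fun y => f (k y) := fun n => (hf n).comp_continuous hk

theorem iff_iteratedDeriv {f : X → ℝ → E} (hf : ∀ x, ContDiff ℝ ∞ (f x)) :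
    IsSmoothFamily f ↔ ∀ n, Continuous (uncurry fun x => iteratedDeriv n (f x)) :=
  ⟨fun h n => (IsCkFamily.iff_iteratedDeriv hf).1 (h n) n le_rfl,
    fun h _ => (IsCkFamily.iff_iteratedDeriv hf).2 fun m _ => h m⟩

theorem of_contDiff {g : ℝ → E} (hg : ContDiff ℝ ∞ g) : IsSmoothFamily fun _ : X => g :=
  (iff_iteratedDeriv fun _ => hg).2 fun n =>
    (hg.continuous_iteratedDeriv n (by exact_mod_cast le_top)).comp continuous_snd

theorem continuous_integral [CompleteSpace E] {f : X → ℝ → E} (hf : IsSmoothFamily f) (a b : ℝ) :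
    Continuous fun x => ∫ θ in a..b, f x θ :=
  intervalIntegral.continuous_parametric_intervalIntegral_of_continuous' hf.continuous a b

theorem integral [CompleteSpace E] {f : X → ℝ → E} (hf : IsSmoothFamily f) :
    IsSmoothFamily fun x θ => ∫ η in (0 : ℝ)..θ, f x η := by
  have hc : Continuous (uncurry fun x θ => ∫ η in (0 : ℝ)..θ, f x η) :=
    intervalIntegral.continuous_parametric_intervalIntegral_of_continuous
      (f := fun (p : X × ℝ) η => f p.1 η) (s := fun p => p.2)
      (hf.continuous.comp ((continuous_fst.comp continuous_fst).prodMk continuous_snd))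
      continuous_snd
  intro n
  cases n with
  | zero => exact hc
  | succ n =>
    exact .succ hc (fun x θ =>
      ((hf.contDiff x).continuous.integral_hasStrictDerivAt 0 θ).hasDerivAt) (hf n)

end IsSmoothFamily

end Families

theorem SmoothLoop.isSmoothFamily_toFun : IsSmoothFamily SmoothLoop.toFun := by
  refine (IsSmoothFamily.iff_iteratedDeriv SmoothLoop.contDiff).2 fun n => ?_
  have h : Continuous (SmoothLoop.derivMap n) :=
    continuous_iff_le_induced.2 (iInf_le _ n)
  exact (h.comp continuous_fst).eval continuous_snd

/-- A map into the Fréchet space of smooth loops is continuous as soon as the family of loops has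
jointly continuous derivatives. -/
theorem SmoothLoop.continuous_of_isSmoothFamily {X : Type*} [TopologicalSpace X]
    {f : X → SmoothLoop} (hf : IsSmoothFamily fun x => (f x).toFun) : Continuous f := by
  refine continuous_iInf_rng.2 fun n => continuous_induced_rng.2 ?_
  exact ContinuousMap.continuous_of_continuous_uncurry _
    ((IsSmoothFamily.iff_iteratedDeriv fun x => (f x).contDiff).1 hf n)

open Real

/-! ### Densities and angles -/

/-- The integral over one period of `u · g(β)`, for a density `u` and an angle function `β`. -/
noncomputable def moment (u β g : ℝ → ℝ) : ℝ := ∫ θ in (0 : ℝ)..2 * π, u θ * g (β θ)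

/-- The determinant of the Gram matrix of `cos β` and `sin β` for the density `u`. For
continuous `u ≥ 0` and `β` it is positive iff, over one period, the direction field `exp (iβ)` does
not stay on a line through `0` where `u ≠ 0`. -/
noncomputable def gramDet (u β : ℝ → ℝ) : ℝ :=
  moment u β (fun t => cos t ^ 2) * moment u β (fun t => sin t ^ 2) -
    moment u β (fun t => cos t * sin t) ^ 2

/-- A nonnegative density `u` and an angle function `β` for which `θ ↦ ∫₀^θ u exp (iβ)` is a
closed, possibly singular, curve whose tangent directions span the plane. -/
structure IsWeakTangent (u β : ℝ → ℝ) : Prop where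
  contDiff_density : ContDiff ℝ ∞ u
  contDiff_angle : ContDiff ℝ ∞ β
  periodic_density : Periodic u (2 * π)
  periodic_angle : Periodic β (2 * π)
  angle_zero : β 0 = 0
  nonneg : ∀ θ, 0 ≤ u θ
  moment_cos : moment u β cos = 0
  moment_sin : moment u β sin = 0
  moment_sin_sq_pos : 0 < moment u β fun t => sin t ^ 2
  gramDet_pos : 0 < gramDet u β

/-- A positive density `r` and an angle function `β` for which `θ ↦ ∫₀^θ r exp (iβ)` is a closed
immersed curve of rotation degree `0`. -/
structure IsTangent (r β : ℝ → ℝ) : Prop where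
  contDiff_density : ContDiff ℝ ∞ r
  contDiff_angle : ContDiff ℝ ∞ β
  periodic_density : Periodic r (2 * π)
  periodic_angle : Periodic β (2 * π)
  angle_zero : β 0 = 0
  pos : ∀ θ, 0 < r θ
  moment_cos : moment r β cos = 0
  moment_sin : moment r β sin = 0

/-- If an angle function vanishing at `0` admits a closed positive density, then it reaches a
direction orthogonal to the initial one. -/
theorem IsTangent.exists_cos_eq_zero {r β : ℝ → ℝ} (h : IsTangent r β) :
    ∃ θ ∈ Set.Icc 0 (2 * π), cos (β θ) = 0 := by
  have hc : Continuous fun θ => cos (β θ) := continuous_cos.comp h.contDiff_angle.continuous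
  by_contra! hne
  have hpos : ∀ θ ∈ Set.Icc 0 (2 * π), 0 < cos (β θ) := by
    intro θ hθ
    by_contra! hle
    obtain ⟨η, hη, hη0⟩ := intermediate_value_Icc' hθ.1 hc.continuousOn
      (show (0 : ℝ) ∈ Set.Icc _ _ from ⟨hle, by simp [h.angle_zero]⟩)
    exact hne η ⟨hη.1, hη.2.trans hθ.2⟩ hη0
  have : 0 < moment r β cos := by
    refine intervalIntegral.intervalIntegral_pos_of_pos_on
      ((h.contDiff_density.continuous.mul hc).intervalIntegrable _ _)
      (fun θ hθ => mul_pos (h.pos θ) (hpos θ ⟨hθ.1.le, hθ.2.le⟩)) (by positivity)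
  exact this.ne' h.moment_cos

theorem moment_add {u β g₁ g₂ : ℝ → ℝ} (hu : Continuous u) (hβ : Continuous β)
    (h₁ : Continuous g₁) (h₂ : Continuous g₂) :
    moment u β (fun t => g₁ t + g₂ t) = moment u β g₁ + moment u β g₂ := by
  unfold moment
  rw [← intervalIntegral.integral_add (Continuous.intervalIntegrable (by fun_prop) _ _)
    (Continuous.intervalIntegrable (by fun_prop) _ _)]
  simp only [mul_add]

theorem moment_const_mul {u β g : ℝ → ℝ} (a : ℝ) :
    moment u β (fun t => a * g t) = a * moment u β g := by
  unfold moment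
  rw [← intervalIntegral.integral_const_mul]
  congr 1; ext θ; ring

theorem IsTangent.moment_sq_pos {r β g : ℝ → ℝ} (h : IsTangent r β) (hg : Continuous g) {θ : ℝ}
    (hθ : θ ∈ Set.Icc 0 (2 * π)) (hne : g (β θ) ≠ 0) : 0 < moment r β fun t => g t ^ 2 := by
  have hr := h.contDiff_density.continuous
  have hβ := h.contDiff_angle.continuous
  refine intervalIntegral.integral_pos (by positivity) (by fun_prop)
    (fun η _ => mul_nonneg (h.pos η).le (sq_nonneg _)) ⟨θ, hθ, mul_pos (h.pos θ) (by positivity)⟩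

/-- A closed immersed curve of rotation degree `0` has tangent directions spanning the plane. -/
theorem IsTangent.isWeakTangent {r β : ℝ → ℝ} (h : IsTangent r β) : IsWeakTangent r β := by
  have hr := h.contDiff_density.continuous
  have hβ := h.contDiff_angle.continuous
  have hC : 0 < moment r β fun t => sin t ^ 2 := by
    obtain ⟨θ, hθ, h0⟩ := h.exists_cos_eq_zero
    refine h.moment_sq_pos continuous_sin hθ fun hs => ?_
    have := sin_sq_add_cos_sq (β θ)
    simp [hs, h0] at this
  refine ⟨h.1, h.2, h.3, h.4, h.5, fun θ => (h.pos θ).le, h.7, h.8, hC, ?_⟩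
  set A := moment r β fun t => cos t ^ 2 with hA
  set B := moment r β fun t => cos t * sin t with hB
  set C := moment r β fun t => sin t ^ 2 with hCdef
  -- The quadratic form of the Gram matrix at `(C, -B)` is `C` times the determinant, and its
  -- integrand does not vanish at `θ = 0`, where `cos β = 1` and `sin β = 0`.
  have h1 : 0 < moment r β fun t => (C * cos t + (-B) * sin t) ^ 2 :=
    h.moment_sq_pos (by fun_prop) (θ := 0) ⟨le_rfl, by positivity⟩
      (by simp [h.angle_zero, hC.ne'])
  have h2 : (moment r β fun t => (C * cos t + (-B) * sin t) ^ 2) = C * gramDet r β := by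
    have : (fun t => (C * cos t + (-B) * sin t) ^ 2) = fun t =>
        C ^ 2 * cos t ^ 2 + ((-2 * B * C) * (cos t * sin t) + B ^ 2 * sin t ^ 2) := by
      ext t; ring
    rw [this, moment_add hr hβ (by fun_prop) (by fun_prop),
      moment_add hr hβ (by fun_prop) (by fun_prop), moment_const_mul, moment_const_mul,
      moment_const_mul, ← hA, ← hB, ← hCdef]
    simp only [gramDet, ← hA, ← hB, ← hCdef]
    ring
  exact pos_of_mul_pos_right (h2 ▸ h1) hC.le

/-! ### Making a density positive -/

/-- First coordinate of `adj(M) e`, where `M` is the Gram matrix of `cos β`, `sin β` for the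
density `u` and `e = ∫ exp (iβ)`. -/
noncomputable def corrCos (u β : ℝ → ℝ) : ℝ :=
  moment u β (fun t => sin t ^ 2) * moment (fun _ => 1) β cos -
    moment u β (fun t => cos t * sin t) * moment (fun _ => 1) β sin

/-- Second coordinate of `adj(M) e`, see `corrCos`. -/
noncomputable def corrSin (u β : ℝ → ℝ) : ℝ :=
  moment u β (fun t => cos t ^ 2) * moment (fun _ => 1) β sin -
    moment u β (fun t => cos t * sin t) * moment (fun _ => 1) β cos

/-- A canonical positive closed density for the angle function `β`, built from a nonnegative one.
Adding the constant `gramDet u β` to a multiple of `u` makes the density positive, and the factor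
linear in `cos β`, `sin β` restores the closing condition; the coefficient of `u` is positive
because `1 + x² + y²` exceeds the length of `(x, y)`. -/
noncomputable def posDensity (u β : ℝ → ℝ) (θ : ℝ) : ℝ :=
  u θ * (1 + corrCos u β ^ 2 + corrSin u β ^ 2 -
    (corrCos u β * cos (β θ) + corrSin u β * sin (β θ))) + gramDet u β

theorem moment_posDensity {u β g : ℝ → ℝ} (hu : Continuous u) (hβ : Continuous β)
    (hg : Continuous g) : moment (posDensity u β) β g =
      (1 + corrCos u β ^ 2 + corrSin u β ^ 2) * moment u β g -
        (corrCos u β * moment u β (fun t => cos t * g t) +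
          corrSin u β * moment u β (fun t => sin t * g t)) +
        gramDet u β * moment (fun _ => 1) β g := by
  simp only [← moment_const_mul]
  unfold moment
  rw [← intervalIntegral.integral_add (Continuous.intervalIntegrable (by fun_prop) _ _)
    (Continuous.intervalIntegrable (by fun_prop) _ _),
    ← intervalIntegral.integral_sub (Continuous.intervalIntegrable (by fun_prop) _ _)
    (Continuous.intervalIntegrable (by fun_prop) _ _),
    ← intervalIntegral.integral_add (Continuous.intervalIntegrable (by fun_prop) _ _)
    (Continuous.intervalIntegrable (by fun_prop) _ _)]
  congr 1; ext θ; simp only [posDensity]; ring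

theorem IsWeakTangent.isTangent_posDensity {u β : ℝ → ℝ} (h : IsWeakTangent u β) :
    IsTangent (posDensity u β) β := by
  have hu := h.contDiff_density.continuous
  have hβ := h.contDiff_angle.continuous
  refine ⟨?_, h.contDiff_angle, fun θ => ?_, h.periodic_angle, h.angle_zero, fun θ => ?_, ?_, ?_⟩
  · exact (h.contDiff_density.mul (contDiff_const.sub
      ((contDiff_const.mul (contDiff_cos.comp h.contDiff_angle)).add
        (contDiff_const.mul (contDiff_sin.comp h.contDiff_angle))))).add contDiff_const
  · simp only [posDensity, h.periodic_density θ, h.periodic_angle θ]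
  · have hD := h.gramDet_pos
    have : 0 ≤ 1 + corrCos u β ^ 2 + corrSin u β ^ 2 -
        (corrCos u β * cos (β θ) + corrSin u β * sin (β θ)) := by
      nlinarith [sq_nonneg (2 * corrCos u β - cos (β θ)), sq_nonneg (2 * corrSin u β - sin (β θ)),
        sin_sq_add_cos_sq (β θ)]
    exact add_pos_of_nonneg_of_pos (mul_nonneg (h.nonneg θ) this) hD
  · rw [moment_posDensity hu hβ continuous_cos, h.moment_cos]
    have h1 : (fun t => cos t * cos t) = fun t => cos t ^ 2 := by ext; ring
    have h2 : (fun t => sin t * cos t) = fun t => cos t * sin t := by ext; ring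
    rw [h1, h2, gramDet]
    simp only [corrCos, corrSin]
    ring
  · rw [moment_posDensity hu hβ continuous_sin, h.moment_sin]
    have h1 : (fun t => sin t * sin t) = fun t => sin t ^ 2 := by ext; ring
    rw [h1, gramDet]
    simp only [corrCos, corrSin]
    ring

theorem IsTangent.convex {r₀ r₁ β : ℝ → ℝ} (h₀ : IsTangent r₀ β) (h₁ : IsTangent r₁ β) {t : ℝ}
    (ht : t ∈ Set.Icc (0 : ℝ) 1) : IsTangent (fun θ => (1 - t) * r₀ θ + t * r₁ θ) β := by
  have hβ := h₀.contDiff_angle.continuous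
  have hm : ∀ g : ℝ → ℝ, Continuous g → moment (fun θ => (1 - t) * r₀ θ + t * r₁ θ) β g =
      (1 - t) * moment r₀ β g + t * moment r₁ β g := by
    intro g hg
    have := h₀.contDiff_density.continuous
    have := h₁.contDiff_density.continuous
    simp only [← moment_const_mul]
    unfold moment
    rw [← intervalIntegral.integral_add (Continuous.intervalIntegrable (by fun_prop) _ _)
      (Continuous.intervalIntegrable (by fun_prop) _ _)]
    congr 1; ext θ; ring
  refine ⟨(contDiff_const.mul h₀.1).add (contDiff_const.mul h₁.1), h₀.2, fun θ => ?_, h₀.4, h₀.5,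
    fun θ => ?_, ?_, ?_⟩
  · simp only [h₀.periodic_density θ, h₁.periodic_density θ]
  · have a := h₀.pos θ
    have b := h₁.pos θ
    rcases eq_or_lt_of_le ht.1 with rfl | h0
    · simpa using a
    · exact add_pos_of_nonneg_of_pos (mul_nonneg (by linarith [ht.2]) a.le) (mul_pos h0 b)
  · rw [hm _ continuous_cos, h₀.moment_cos, h₁.moment_cos]; ring
  · rw [hm _ continuous_sin, h₀.moment_sin, h₁.moment_sin]; ring

section Families

variable {X : Type*} [TopologicalSpace X] {u β : X → ℝ → ℝ}

theorem IsSmoothFamily.continuous_moment (hu : IsSmoothFamily u) (hβ : IsSmoothFamily β)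
    {g : ℝ → ℝ} (hg : ContDiff ℝ ∞ g) : Continuous fun x => moment (u x) (β x) g :=
  (hu.mul (hβ.contDiff_comp hg)).continuous_integral _ _

theorem IsSmoothFamily.posDensity (hu : IsSmoothFamily u) (hβ : IsSmoothFamily β) :
    IsSmoothFamily fun x => posDensity (u x) (β x) := by
  have hA := hu.continuous_moment hβ (contDiff_cos.pow 2)
  have hB := hu.continuous_moment hβ (contDiff_cos.mul contDiff_sin)
  have hC := hu.continuous_moment hβ (contDiff_sin.pow 2)
  have h1 : IsSmoothFamily fun (_ : X) (_ : ℝ) => (1 : ℝ) := .const continuous_const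
  have e₁ := h1.continuous_moment hβ contDiff_cos
  have e₂ := h1.continuous_moment hβ contDiff_sin
  have hD : Continuous fun x => gramDet (u x) (β x) := (hA.mul hC).sub (hB.pow 2)
  have hx : Continuous fun x => corrCos (u x) (β x) := (hC.mul e₁).sub (hB.mul e₂)
  have hy : Continuous fun x => corrSin (u x) (β x) := (hA.mul e₂).sub (hB.mul e₁)
  have h : IsSmoothFamily fun x θ => u x θ * ((1 + corrCos (u x) (β x) ^ 2 +
      corrSin (u x) (β x) ^ 2) + (-corrCos (u x) (β x) * cos (β x θ) +
        -corrSin (u x) (β x) * sin (β x θ))) + gramDet (u x) (β x) :=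
    (hu.mul ((IsSmoothFamily.const (by fun_prop)).add
      (((IsSmoothFamily.const hx.neg).mul (hβ.contDiff_comp contDiff_cos)).add
        ((IsSmoothFamily.const hy.neg).mul (hβ.contDiff_comp contDiff_sin))))).add
      (IsSmoothFamily.const hD)
  convert h using 3
  simp only [PlaneCurve.posDensity]
  ring

end Families

/-! ### Reparametrisations -/

/-- A monotone smooth map `φ` of degree one of the circle fixing the base point, lifted to `ℝ`,
with derivative `φ'`. It need not be a diffeomorphism: `φ'` may vanish on intervals. -/
structure IsReparam (φ φ' : ℝ → ℝ) : Prop where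
  contDiff : ContDiff ℝ ∞ φ
  contDiff_deriv : ContDiff ℝ ∞ φ'
  hasDerivAt : ∀ θ, HasDerivAt φ (φ' θ) θ
  map_zero : φ 0 = 0
  map_add : ∀ θ, φ (θ + 2 * π) = φ θ + 2 * π
  nonneg : ∀ θ, 0 ≤ φ' θ

namespace IsReparam

variable {φ φ' ψ ψ' : ℝ → ℝ}

theorem moment_comp (h : IsReparam φ φ') {r β g : ℝ → ℝ} (hr : Continuous r) (hβ : Continuous β)
    (hg : Continuous g) :
    moment (fun θ => r (φ θ) * φ' θ) (fun θ => β (φ θ)) g = moment r β g := by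
  have := intervalIntegral.integral_comp_mul_deriv (a := 0) (b := 2 * π)
    (g := fun η => r η * g (β η)) (fun θ _ => h.hasDerivAt θ)
    h.contDiff_deriv.continuous.continuousOn (by fun_prop)
  have h2 : φ (2 * π) = 2 * π := by simpa [h.map_zero] using h.map_add 0
  rw [h.map_zero, h2] at this
  rw [moment, moment, ← this]
  congr 1; ext θ; simp only [comp_apply]; ring

theorem id : IsReparam (fun θ => θ) fun _ => 1 :=
  ⟨contDiff_id, contDiff_const, hasDerivAt_id, rfl, fun _ => rfl, fun _ => zero_le_one⟩

theorem convex (h : IsReparam φ φ') (k : IsReparam ψ ψ') {t : ℝ} (ht : t ∈ Set.Icc (0 : ℝ) 1) :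
    IsReparam (fun θ => (1 - t) * φ θ + t * ψ θ) (fun θ => (1 - t) * φ' θ + t * ψ' θ) where
  contDiff := (contDiff_const.mul h.1).add (contDiff_const.mul k.1)
  contDiff_deriv := (contDiff_const.mul h.2).add (contDiff_const.mul k.2)
  hasDerivAt θ := ((h.3 θ).const_mul _).add ((k.3 θ).const_mul _)
  map_zero := by rw [h.map_zero, k.map_zero]; ring
  map_add θ := by rw [h.map_add, k.map_add]; ring
  nonneg θ := add_nonneg (mul_nonneg (by linarith [ht.2]) (h.nonneg θ))
    (mul_nonneg ht.1 (k.nonneg θ))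

end IsReparam

/-- The derivative of `collapse`: a smooth nonnegative periodic function with integral `2π` over a
period, which is supported where `sin θ ≥ 0`. -/
noncomputable def collapseDeriv (θ : ℝ) : ℝ :=
  2 * π / (∫ η in (0 : ℝ)..2 * π, expNegInvGlue (sin η)) * expNegInvGlue (sin θ)

/-- A monotone map of degree one of the circle which stretches the first half `[0, π]` over the
whole circle and collapses the second half `[π, 2π]` to the base point. -/
noncomputable def collapse (θ : ℝ) : ℝ := ∫ η in (0 : ℝ)..θ, collapseDeriv η

theorem contDiff_collapseDeriv : ContDiff ℝ ∞ collapseDeriv :=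
  contDiff_const.mul (expNegInvGlue.contDiff.comp contDiff_sin)

theorem periodic_collapseDeriv : Periodic collapseDeriv (2 * π) := fun θ => by
  simp [collapseDeriv]

theorem integral_expNegInvGlue_sin_pos : 0 < ∫ η in (0 : ℝ)..2 * π, expNegInvGlue (sin η) := by
  refine intervalIntegral.integral_pos (by positivity)
    ((expNegInvGlue.contDiff (n := 0)).continuous.comp continuous_sin).continuousOn
    (fun η _ => expNegInvGlue.nonneg _)
    ⟨π / 2, ⟨by positivity, by linarith [pi_pos]⟩, expNegInvGlue.pos_of_pos (by simp)⟩

theorem hasDerivAt_collapse (θ : ℝ) : HasDerivAt collapse (collapseDeriv θ) θ :=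
  (contDiff_collapseDeriv.continuous.integral_hasStrictDerivAt 0 θ).hasDerivAt

theorem collapse_two_pi : collapse (2 * π) = 2 * π := by
  have := integral_expNegInvGlue_sin_pos.ne'
  simp only [collapse, collapseDeriv, intervalIntegral.integral_const_mul]
  field_simp

theorem isReparam_collapse : IsReparam collapse collapseDeriv where
  contDiff := by
    have h : deriv collapse = collapseDeriv := funext fun θ => (hasDerivAt_collapse θ).deriv
    exact contDiff_infty_iff_deriv.2
      ⟨fun θ => (hasDerivAt_collapse θ).differentiableAt, h ▸ contDiff_collapseDeriv⟩
  contDiff_deriv := contDiff_collapseDeriv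
  hasDerivAt := hasDerivAt_collapse
  map_zero := by simp [collapse]
  map_add θ := by
    have hi : ∀ a b, IntervalIntegrable collapseDeriv MeasureTheory.volume a b :=
      fun a b => contDiff_collapseDeriv.continuous.intervalIntegrable a b
    have h := periodic_collapseDeriv.intervalIntegral_add_eq θ 0
    rw [zero_add] at h
    rw [collapse, ← intervalIntegral.integral_add_adjacent_intervals (hi 0 θ) (hi θ _), h]
    exact congrArg (collapse θ + ·) collapse_two_pi
  nonneg θ := mul_nonneg (div_nonneg (by positivity) integral_expNegInvGlue_sin_pos.le)
    (expNegInvGlue.nonneg _)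

theorem collapseDeriv_eq_zero {θ : ℝ} (hθ : θ ∈ Set.Icc π (2 * π)) : collapseDeriv θ = 0 := by
  have : sin θ ≤ 0 := by
    rw [← sin_sub_two_pi]
    exact sin_nonpos_of_nonpos_of_neg_pi_le (by linarith [hθ.2]) (by linarith [hθ.1])
  simp [collapseDeriv, expNegInvGlue.zero_of_nonpos this]

theorem collapse_eq_two_pi {θ : ℝ} (hθ : θ ∈ Set.Icc π (2 * π)) : collapse θ = 2 * π := by
  have hi : ∀ a b, IntervalIntegrable collapseDeriv MeasureTheory.volume a b :=
    fun a b => contDiff_collapseDeriv.continuous.intervalIntegrable a b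
  have h0 : ∫ η in θ..2 * π, collapseDeriv η = 0 := by
    rw [intervalIntegral.integral_congr (g := fun _ => 0), intervalIntegral.integral_zero]
    intro η hη
    rw [Set.uIcc_of_le hθ.2] at hη
    exact collapseDeriv_eq_zero ⟨hθ.1.trans hη.1, hη.2⟩
  have := intervalIntegral.integral_add_adjacent_intervals (hi 0 θ) (hi θ (2 * π))
  rw [h0, add_zero] at this
  exact this.trans collapse_two_pi

/-- The conjugate of `collapse` by a half turn: it collapses the first half of the circle and
stretches the second half over the whole circle. -/
noncomputable def collapse' (θ : ℝ) : ℝ := collapse (θ + π) - 2 * π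

theorem collapse'_eq_zero {θ : ℝ} (hθ : θ ∈ Set.Icc 0 π) : collapse' θ = 0 := by
  rw [collapse', collapse_eq_two_pi ⟨by linarith [hθ.1], by linarith [hθ.2]⟩, sub_self]

theorem isReparam_collapse' : IsReparam collapse' fun θ => collapseDeriv (θ + π) where
  contDiff := (isReparam_collapse.contDiff.comp (contDiff_id.add contDiff_const)).sub contDiff_const
  contDiff_deriv := contDiff_collapseDeriv.comp (contDiff_id.add contDiff_const)
  hasDerivAt θ := ((hasDerivAt_collapse (θ + π)).comp_add_const θ π).sub_const (2 * π)
  map_zero := collapse'_eq_zero ⟨le_rfl, pi_pos.le⟩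
  map_add θ := by
    rw [collapse', add_right_comm, isReparam_collapse.map_add, collapse']; ring
  nonneg θ := isReparam_collapse.nonneg _

/-! ### Deforming tangent data to a fixed one -/

/-- The density obtained by traversing the curve with density `r₁` in the reparametrisation
`(1 - t) id + t collapse` with weight `1 - q`, and the one with density `r₂` in the
reparametrisation `collapse'` with weight `q`. -/
noncomputable def deformDensity (r₁ r₂ : ℝ → ℝ) (t q θ : ℝ) : ℝ :=
  (1 - q) * (r₁ ((1 - t) * θ + t * collapse θ) * ((1 - t) * 1 + t * collapseDeriv θ)) +
    q * (r₂ (collapse' θ) * collapseDeriv (θ + π))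

/-- The superposition of the angle functions `β₁`, reparametrised by `(1 - t) id + t collapse` and
scaled by `1 - p`, and `β₂`, reparametrised by `collapse'` and scaled by `s`. -/
noncomputable def deformAngle (β₁ β₂ : ℝ → ℝ) (t s p θ : ℝ) : ℝ :=
  (1 - p) * β₁ ((1 - t) * θ + t * collapse θ) + s * β₂ (collapse' θ)

/-- Each of the two densities only sees its own angle function, because at `t = 1` the two
reparametrisations have derivatives with disjoint supports, each being constant on the support of
the derivative of the other. -/
theorem moment_deform {r₁ r₂ β₁ β₂ g : ℝ → ℝ} (h₁ : IsTangent r₁ β₁) (h₂ : IsTangent r₂ β₂)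
    (hg : Continuous g) {t s q p : ℝ} (ht : t ∈ Set.Icc (0 : ℝ) 1) (hst : s = 0 ∨ t = 1)
    (hqs : q = 0 ∨ s = 1 ∧ t = 1) (hpq : q = 1 ∨ p = 0) :
    moment (deformDensity r₁ r₂ t q) (deformAngle β₁ β₂ t s p) g =
      (1 - q) * moment r₁ β₁ g + q * moment r₂ β₂ g := by
  have c₁ := h₁.contDiff_density.continuous
  have c₂ := h₂.contDiff_density.continuous
  have b₁ := h₁.contDiff_angle.continuous
  have b₂ := h₂.contDiff_angle.continuous
  have k₁ := IsReparam.id.convex isReparam_collapse ht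
  have k₂ := isReparam_collapse'
  have d₁ := k₁.contDiff.continuous
  have d₂ := k₂.contDiff.continuous
  have e₁ := k₁.contDiff_deriv.continuous
  have e₂ := k₂.contDiff_deriv.continuous
  rw [← k₁.moment_comp c₁ b₁ hg, ← k₂.moment_comp c₂ b₂ hg, ← moment_const_mul,
    ← moment_const_mul]
  unfold moment
  rw [← intervalIntegral.integral_add (Continuous.intervalIntegrable (by fun_prop) _ _)
    (Continuous.intervalIntegrable (by fun_prop) _ _)]
  refine intervalIntegral.integral_congr fun θ hθ => ?_
  rw [Set.uIcc_of_le (by positivity)] at hθ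
  simp only [deformDensity, deformAngle]
  rcases le_total θ π with hπ | hπ
  · rw [collapse'_eq_zero ⟨hθ.1, hπ⟩,
      collapseDeriv_eq_zero (θ := θ + π) ⟨by linarith [hθ.1], by linarith⟩, h₂.angle_zero]
    rcases hpq with rfl | rfl
    · simp
    · simp; ring
  · have hz : β₁ (2 * π) = 0 := by simpa [h₁.angle_zero] using h₁.periodic_angle 0
    rcases hst with rfl | rfl
    · obtain rfl : q = 0 := by rcases hqs with h | h; exacts [h, absurd h.1 zero_ne_one]
      obtain rfl : p = 0 := by rcases hpq with h | h; exacts [absurd h zero_ne_one, h]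
      simp
    · rw [collapse_eq_two_pi ⟨hπ, hθ.2⟩, collapseDeriv_eq_zero ⟨hπ, hθ.2⟩]
      rcases hqs with rfl | ⟨rfl, -⟩
      · simp [hz]
      · simp [hz]; ring

theorem det_convex_pos {A₁ B₁ C₁ A₂ B₂ C₂ q : ℝ} (hC₁ : 0 < C₁) (hC₂ : 0 < C₂)
    (h₁ : 0 < A₁ * C₁ - B₁ ^ 2) (h₂ : 0 < A₂ * C₂ - B₂ ^ 2) (hq : q ∈ Set.Icc (0 : ℝ) 1) :
    0 < ((1 - q) * A₁ + q * A₂) * ((1 - q) * C₁ + q * C₂) - ((1 - q) * B₁ + q * B₂) ^ 2 := by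
  have hcross : 0 ≤ A₁ * C₂ + A₂ * C₁ - 2 * B₁ * B₂ := by
    refine nonneg_of_mul_nonneg_right (a := C₁ * C₂) ?_ (mul_pos hC₁ hC₂)
    have : C₁ * C₂ * (A₁ * C₂ + A₂ * C₁ - 2 * B₁ * B₂) = C₂ ^ 2 * (A₁ * C₁ - B₁ ^ 2) +
        C₁ ^ 2 * (A₂ * C₂ - B₂ ^ 2) + (C₂ * B₁ - C₁ * B₂) ^ 2 := by ring
    rw [this]; positivity
  have heq : ((1 - q) * A₁ + q * A₂) * ((1 - q) * C₁ + q * C₂) - ((1 - q) * B₁ + q * B₂) ^ 2 =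
      (1 - q) ^ 2 * (A₁ * C₁ - B₁ ^ 2) + q ^ 2 * (A₂ * C₂ - B₂ ^ 2) +
        q * (1 - q) * (A₁ * C₂ + A₂ * C₁ - 2 * B₁ * B₂) := by ring
  rw [heq]
  have hx : 0 ≤ q * (1 - q) * (A₁ * C₂ + A₂ * C₁ - 2 * B₁ * B₂) :=
    mul_nonneg (mul_nonneg hq.1 (by linarith [hq.2])) hcross
  rcases eq_or_lt_of_le hq.1 with rfl | h0
  · simpa using h₁
  · have : 0 < q ^ 2 * (A₂ * C₂ - B₂ ^ 2) := by positivity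
    have : 0 ≤ (1 - q) ^ 2 * (A₁ * C₁ - B₁ ^ 2) := by positivity
    linarith

theorem isWeakTangent_deform {r₁ r₂ β₁ β₂ : ℝ → ℝ} (h₁ : IsTangent r₁ β₁) (h₂ : IsTangent r₂ β₂)
    {t s q p : ℝ} (ht : t ∈ Set.Icc (0 : ℝ) 1) (hq : q ∈ Set.Icc (0 : ℝ) 1)
    (hst : s = 0 ∨ t = 1) (hqs : q = 0 ∨ s = 1 ∧ t = 1) (hpq : q = 1 ∨ p = 0) :
    IsWeakTangent (deformDensity r₁ r₂ t q) (deformAngle β₁ β₂ t s p) := by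
  have k₁ := IsReparam.id.convex isReparam_collapse ht
  have k₂ := isReparam_collapse'
  have hm : ∀ {g : ℝ → ℝ}, Continuous g → _ := fun hg => moment_deform h₁ h₂ hg ht hst hqs hpq
  have w₁ := h₁.isWeakTangent
  have w₂ := h₂.isWeakTangent
  constructor
  · exact (contDiff_const.mul ((h₁.contDiff_density.comp k₁.contDiff).mul k₁.contDiff_deriv)).add
      (contDiff_const.mul ((h₂.contDiff_density.comp k₂.contDiff).mul k₂.contDiff_deriv))
  · exact (contDiff_const.mul (h₁.contDiff_angle.comp k₁.contDiff)).add
      (contDiff_const.mul (h₂.contDiff_angle.comp k₂.contDiff))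
  · intro θ
    simp only [deformDensity]
    rw [k₁.map_add, k₂.map_add, h₁.periodic_density, h₂.periodic_density, add_right_comm θ,
      periodic_collapseDeriv, periodic_collapseDeriv]
  · intro θ
    simp only [deformAngle]
    rw [k₁.map_add, k₂.map_add, h₁.periodic_angle, h₂.periodic_angle]
  · simp only [deformAngle]
    rw [k₁.map_zero, k₂.map_zero, h₁.angle_zero, h₂.angle_zero]
    ring
  · exact fun θ => add_nonneg
      (mul_nonneg (by linarith [hq.2]) (mul_nonneg (h₁.pos _).le (k₁.nonneg θ)))
      (mul_nonneg hq.1 (mul_nonneg (h₂.pos _).le (k₂.nonneg θ)))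
  · rw [hm continuous_cos, h₁.moment_cos, h₂.moment_cos]; ring
  · rw [hm continuous_sin, h₁.moment_sin, h₂.moment_sin]; ring
  · rw [hm (by fun_prop)]
    have a := w₁.moment_sin_sq_pos
    have b := w₂.moment_sin_sq_pos
    rcases eq_or_lt_of_le hq.1 with rfl | h0
    · simpa using a
    · exact add_pos_of_nonneg_of_pos (mul_nonneg (by linarith [hq.2]) a.le) (mul_pos h0 b)
  · rw [gramDet, hm (by fun_prop), hm (by fun_prop), hm (by fun_prop)]
    exact det_convex_pos w₁.moment_sin_sq_pos w₂.moment_sin_sq_pos w₁.gramDet_pos w₂.gramDet_pos hq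

/-! ### A figure eight -/

/-- The velocity `cos 2θ + i sin θ` of a figure eight. It avoids the half line `(-∞, 0]`, so that
its principal argument is smooth. -/
noncomputable def eightVelocity (θ : ℝ) : ℂ := ⟨cos (2 * θ), sin θ⟩

theorem contDiff_eightVelocity : ContDiff ℝ ∞ eightVelocity :=
  Complex.equivRealProdCLM.symm.contDiff.comp
    ((contDiff_cos.comp (contDiff_const.mul contDiff_id)).prodMk contDiff_sin)

theorem eightVelocity_mem_slitPlane (θ : ℝ) : eightVelocity θ ∈ Complex.slitPlane := by
  rw [Complex.mem_slitPlane_iff]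
  by_cases h : sin θ = 0
  · exact .inl (by simp [eightVelocity, cos_two_mul, cos_sq', h])
  · exact .inr h

theorem isTangent_eight :
    IsTangent (fun θ => ‖eightVelocity θ‖) fun θ => Complex.arg (eightVelocity θ) where
  contDiff_density := contDiff_eightVelocity.norm ℝ fun θ =>
    Complex.slitPlane_ne_zero (eightVelocity_mem_slitPlane θ)
  contDiff_angle := by
    have : ContDiff ℝ ∞ fun θ => Complex.log (eightVelocity θ) :=
      contDiff_iff_contDiffAt.2 fun θ =>
        ((Complex.contDiffAt_log (eightVelocity_mem_slitPlane θ)).restrict_scalars ℝ).comp θ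
          contDiff_eightVelocity.contDiffAt
    simpa [comp_def, Complex.log_im] using Complex.imCLM.contDiff.comp this
  periodic_density θ := by
    simp only [eightVelocity, mul_add, sin_add_two_pi]
    rw [show 2 * (2 * π) = (2 : ℕ) * (2 * π) by norm_num, cos_add_nat_mul_two_pi]
  periodic_angle θ := by
    simp only [eightVelocity, mul_add, sin_add_two_pi]
    rw [show 2 * (2 * π) = (2 : ℕ) * (2 * π) by norm_num, cos_add_nat_mul_two_pi]
  angle_zero := by
    have : eightVelocity 0 = 1 := by apply Complex.ext <;> simp [eightVelocity]
    rw [this, Complex.arg_one]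
  pos θ := norm_pos_iff.2 (Complex.slitPlane_ne_zero (eightVelocity_mem_slitPlane θ))
  moment_cos := by
    simp only [moment, Complex.norm_mul_cos_arg, eightVelocity]
    rw [intervalIntegral.integral_comp_mul_left (fun x => cos x) two_ne_zero, integral_cos,
      show 2 * (2 * π) = (2 : ℕ) * (2 * π) by norm_num, ← zero_add ((2 : ℕ) * (2 * π)),
      sin_add_nat_mul_two_pi]
    simp
  moment_sin := by
    simp only [moment, Complex.norm_mul_sin_arg, eightVelocity]
    simp

open unitInterval

/-! ### From tangent data to immersions -/

theorem integral_exp_eq {r β : ℝ → ℝ} (hr : Continuous r) (hβ : Continuous β) :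
    ∫ θ in (0 : ℝ)..2 * π, (r θ : ℂ) * Complex.exp (Complex.I * (β θ : ℂ)) =
      moment r β cos + Complex.I * moment r β sin := by
  unfold moment
  rw [← intervalIntegral.integral_ofReal, ← intervalIntegral.integral_ofReal,
    ← intervalIntegral.integral_const_mul, ← intervalIntegral.integral_add
    (Continuous.intervalIntegrable (by fun_prop) _ _)
    (Continuous.intervalIntegrable (by fun_prop) _ _)]
  congr 1; ext θ
  rw [mul_comm Complex.I, Complex.exp_mul_I]
  push_cast
  ring

/-- The velocity `z r exp (iβ)` with initial direction `z`, density `r` and angle function `β`. -/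
noncomputable def velocity (z : Circle) (r β : ℝ → ℝ) (θ : ℝ) : ℂ :=
  z * (r θ * Complex.exp (Complex.I * (β θ : ℂ)))

section Families

variable {X : Type*} [TopologicalSpace X]

theorem IsSmoothFamily.velocity {z : X → Circle} {r β : X → ℝ → ℝ} (hz : Continuous z)
    (hr : IsSmoothFamily r) (hβ : IsSmoothFamily β) :
    IsSmoothFamily fun x => velocity (z x) (r x) (β x) := by
  have h1 : IsSmoothFamily fun x θ => (r x θ : ℂ) := hr.contDiff_comp Complex.ofRealCLM.contDiff
  have h2 : IsSmoothFamily fun x θ => Complex.exp (Complex.I * (β x θ : ℂ)) :=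
    hβ.contDiff_comp (g := fun t : ℝ => Complex.exp (Complex.I * (t : ℂ)))
      (Complex.contDiff_exp.comp (contDiff_const.mul Complex.ofRealCLM.contDiff))
  exact (IsSmoothFamily.const (continuous_subtype_val.comp hz)).mul (h1.mul h2)

end Families

theorem contDiff_velocity (z : Circle) {r β : ℝ → ℝ} (h : IsTangent r β) :
    ContDiff ℝ ∞ (velocity z r β) :=
  contDiff_const.mul ((Complex.ofRealCLM.contDiff.comp h.contDiff_density).mul
    (Complex.contDiff_exp.comp
      (contDiff_const.mul (Complex.ofRealCLM.contDiff.comp h.contDiff_angle))))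

/-- The closed curve starting at `p` with velocity `velocity z r β`. -/
noncomputable def loopOf (p : ℂ) (z : Circle) {r β : ℝ → ℝ} (h : IsTangent r β) : SmoothLoop where
  toFun θ := p + ∫ η in (0 : ℝ)..θ, velocity z r β η
  contDiff := by
    have hv := contDiff_velocity z h
    have hd : ∀ θ, HasDerivAt (fun θ => ∫ η in (0 : ℝ)..θ, velocity z r β η) (velocity z r β θ) θ :=
      fun θ => (hv.continuous.integral_hasStrictDerivAt 0 θ).hasDerivAt
    refine contDiff_const.add (contDiff_infty_iff_deriv.2 ⟨fun θ => (hd θ).differentiableAt, ?_⟩)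
    rwa [funext fun θ => (hd θ).deriv]
  periodic θ := by
    have hi : ∀ a b, IntervalIntegrable (velocity z r β) MeasureTheory.volume a b :=
      fun a b => (contDiff_velocity z h).continuous.intervalIntegrable a b
    have hp : Periodic (velocity z r β) (2 * π) := fun η => by
      simp only [velocity, h.periodic_density η, h.periodic_angle η]
    have h0 : ∫ η in (0 : ℝ)..2 * π, velocity z r β η = 0 := by
      simp only [velocity]
      rw [intervalIntegral.integral_const_mul, integral_exp_eq h.contDiff_density.continuous
        h.contDiff_angle.continuous, h.moment_cos, h.moment_sin]
      simp
    have h1 := hp.intervalIntegral_add_eq θ 0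
    rw [zero_add, h0] at h1
    simp only
    rw [← intervalIntegral.integral_add_adjacent_intervals (hi 0 θ) (hi θ _), h1, add_zero]

section LoopOf

variable (p : ℂ) (z : Circle) {r β : ℝ → ℝ} (h : IsTangent r β)

theorem deriv_loopOf (θ : ℝ) : deriv (loopOf p z h).toFun θ = velocity z r β θ :=
  (((contDiff_velocity z h).continuous.integral_hasStrictDerivAt 0 θ).hasDerivAt.const_add p).deriv

theorem norm_velocity (θ : ℝ) (hr : 0 < r θ) : ‖velocity z r β θ‖ = r θ := by
  rw [velocity, norm_mul, norm_mul, mul_comm Complex.I, Complex.norm_exp_ofReal_mul_I,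
    Circle.norm_coe, Complex.norm_real, norm_of_nonneg hr.le]
  ring

theorem velocity_div_norm (θ : ℝ) (hr : 0 < r θ) : velocity z r β θ / (‖velocity z r β θ‖ : ℂ) =
    z * Complex.exp (Complex.I * (β θ : ℂ)) := by
  rw [norm_velocity z θ hr, velocity]
  have : (r θ : ℂ) ≠ 0 := by exact_mod_cast hr.ne'
  field_simp

theorem loopOf_mem_Imm : loopOf p z h ∈ Imm 0 := by
  refine ⟨fun θ => ?_, fun θ => Complex.arg z + β θ, ⟨contDiff_const.add h.contDiff_angle,
    fun θ => ?_⟩, fun θ => ?_⟩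
  · rw [deriv_loopOf, ← norm_pos_iff, norm_velocity z θ (h.pos θ)]
    exact h.pos θ
  · rw [deriv_loopOf, velocity_div_norm z θ (h.pos θ)]
    have : (z : ℂ) = Complex.exp (Complex.I * (Complex.arg z : ℂ)) := by
      rw [mul_comm, ← Circle.coe_exp, Circle.exp_arg]
    push_cast
    rw [mul_add, Complex.exp_add, ← this]
  · simp [h.periodic_angle θ]

end LoopOf

/-- A continuous family of tangent data defines a continuous family of immersions. -/
noncomputable def immOf {X : Type*} [TopologicalSpace X] {p : X → ℂ} {z : X → Circle}
    {r β : X → ℝ → ℝ} (hp : Continuous p) (hz : Continuous z) (hr : IsSmoothFamily r)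
    (hβ : IsSmoothFamily β) (h : ∀ x, IsTangent (r x) (β x)) : C(X, Imm 0) where
  toFun x := ⟨loopOf (p x) (z x) (h x), loopOf_mem_Imm _ _ _⟩
  continuous_toFun := Continuous.subtype_mk (SmoothLoop.continuous_of_isSmoothFamily
    ((IsSmoothFamily.const hp).add (IsSmoothFamily.velocity hz hr hβ).integral)) _

theorem SmoothLoop.toFun_injective : Injective SmoothLoop.toFun := by
  rintro ⟨f, hf, hf'⟩ ⟨g, hg, hg'⟩ h
  obtain rfl : f = g := h
  rfl

theorem Imm.ext_loopOf {c : Imm 0} {p : ℂ} {z : Circle} {r β : ℝ → ℝ} (h : IsTangent r β)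
    (h0 : c.1.toFun 0 = p) (hd : ∀ θ, deriv c.1.toFun θ = velocity z r β θ) :
    (⟨loopOf p z h, loopOf_mem_Imm p z h⟩ : Imm 0) = c := by
  have key : (loopOf p z h).toFun = c.1.toFun := by
    ext θ
    have hv := (contDiff_velocity z h).continuous
    have := intervalIntegral.integral_eq_sub_of_hasDerivAt (a := 0) (b := θ)
      (fun η _ => hd η ▸ (c.1.contDiff.differentiable (by simp) η).hasDerivAt)
      (hv.intervalIntegrable _ _)
    rw [h0] at this
    simp only [loopOf, this]
    ring
  exact Subtype.ext (SmoothLoop.toFun_injective key)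

/-! ### From immersions to tangent data -/

/-- The speed `|c'|`. -/
noncomputable def speed (c : Imm 0) (θ : ℝ) : ℝ := ‖deriv c.1.toFun θ‖

/-- The unit tangent `c' / |c'|`. -/
noncomputable def unitTangent (c : Imm 0) (θ : ℝ) : ℂ :=
  deriv c.1.toFun θ / (‖deriv c.1.toFun θ‖ : ℂ)

/-- The direction of the tangent at the base point. -/
noncomputable def initialDirection (c : Imm 0) : Circle :=
  ⟨unitTangent c 0, by
    have := norm_pos_iff.2 (c.2.1 0)
    simp [unitTangent, Submonoid.unitSphere, this.ne']⟩

/-- The angle from the tangent at the base point to the tangent at `θ`, obtained by integrating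
the logarithmic derivative of the unit tangent, so that it depends continuously on the curve. -/
noncomputable def turningAngle (c : Imm 0) (θ : ℝ) : ℝ :=
  ∫ η in (0 : ℝ)..θ, (starRingEnd ℂ (unitTangent c η) * deriv (unitTangent c) η).im

theorem turningAngle_eq {c : Imm 0} {a : ℝ → ℝ} (ha : c.1.IsArgument a) (θ : ℝ) :
    turningAngle c θ = a θ - a 0 := by
  have he : unitTangent c = fun θ => Complex.exp (Complex.I * (a θ : ℂ)) := funext ha.2
  have hd : ∀ η, HasDerivAt a (deriv a η) η := fun η =>
    (ha.1.differentiable (by simp) η).hasDerivAt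
  have hde : ∀ η, deriv (unitTangent c) η =
      Complex.exp (Complex.I * (a η : ℂ)) * (Complex.I * ((deriv a η : ℝ) : ℂ)) := fun η => by
    rw [he]
    exact (((hd η).ofReal_comp.const_mul Complex.I).cexp).deriv
  rw [← intervalIntegral.integral_eq_sub_of_hasDerivAt (fun η _ => hd η)
    ((ha.1.continuous_deriv (by simp)).intervalIntegrable _ _), turningAngle]
  congr 1; ext η
  have h1 : starRingEnd ℂ (unitTangent c η) * unitTangent c η = 1 := by
    rw [congrFun he η, mul_comm, Complex.mul_conj, Complex.normSq_eq_norm_sq, mul_comm Complex.I,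
      Complex.norm_exp_ofReal_mul_I]
    simp
  have h2 : Complex.exp (Complex.I * (a η : ℂ)) = unitTangent c η := (ha.2 η).symm
  rw [hde, h2, ← mul_assoc, h1]
  simp

theorem deriv_eq_velocity (c : Imm 0) (θ : ℝ) :
    deriv c.1.toFun θ = velocity (initialDirection c) (speed c) (turningAngle c) θ := by
  obtain ⟨a, ha, -⟩ := c.2.2
  have h0 : ((initialDirection c : Circle) : ℂ) = Complex.exp (Complex.I * (a 0 : ℂ)) := ha.2 0
  have h1 := ha.2 θ
  have hn : (‖deriv c.1.toFun θ‖ : ℂ) ≠ 0 := by exact_mod_cast (norm_pos_iff.2 (c.2.1 θ)).ne'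
  rw [div_eq_iff hn] at h1
  rw [velocity, turningAngle_eq ha, h0, mul_left_comm, ← Complex.exp_add, speed]
  conv_lhs => rw [h1]
  rw [mul_comm]
  congr 2
  push_cast
  ring

theorem isSmoothFamily_deriv : IsSmoothFamily fun c : Imm 0 => deriv c.1.toFun :=
  SmoothLoop.isSmoothFamily_toFun.deriv.comp_continuous continuous_subtype_val

theorem contDiffOn_norm_complex : ContDiffOn ℝ ∞ (fun w : ℂ => ‖w‖) {0}ᶜ := fun _ hw =>
  (contDiffAt_norm ℝ hw).contDiffWithinAt

theorem isSmoothFamily_speed : IsSmoothFamily speed :=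
  isSmoothFamily_deriv.contDiffOn_comp isOpen_compl_singleton contDiffOn_norm_complex
    fun c θ => c.2.1 θ

theorem isSmoothFamily_unitTangent : IsSmoothFamily unitTangent := by
  have h : ContDiffOn ℝ ∞ (fun w : ℂ => (‖w‖ : ℂ)⁻¹) {0}ᶜ :=
    (Complex.ofRealCLM.contDiff.comp_contDiffOn contDiffOn_norm_complex).inv
      fun w hw => Complex.ofReal_ne_zero.2 (norm_ne_zero_iff.2 hw)
  have he : unitTangent = fun c θ => deriv c.1.toFun θ * (‖deriv c.1.toFun θ‖ : ℂ)⁻¹ := by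
    ext c θ; exact div_eq_mul_inv _ _
  exact he ▸ isSmoothFamily_deriv.mul
    (isSmoothFamily_deriv.contDiffOn_comp isOpen_compl_singleton h fun c θ => c.2.1 θ)

theorem isSmoothFamily_turningAngle : IsSmoothFamily turningAngle :=
  (((isSmoothFamily_unitTangent.contDiff_comp Complex.conjCLE.contDiff).mul
    isSmoothFamily_unitTangent.deriv).contDiff_comp Complex.imCLM.contDiff).integral

theorem continuous_initialDirection : Continuous initialDirection :=
  Continuous.subtype_mk
    (isSmoothFamily_unitTangent.continuous.comp (continuous_id.prodMk continuous_const)) _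

theorem isTangent_speed_turningAngle (c : Imm 0) : IsTangent (speed c) (turningAngle c) := by
  have hr : ContDiff ℝ ∞ (speed c) := isSmoothFamily_speed.contDiff c
  have hβ : ContDiff ℝ ∞ (turningAngle c) := isSmoothFamily_turningAngle.contDiff c
  have hcd : Continuous (deriv c.1.toFun) := c.1.contDiff.continuous_deriv (by simp)
  have hclosed : (moment (speed c) (turningAngle c) cos : ℂ) +
      Complex.I * moment (speed c) (turningAngle c) sin = 0 := by
    rw [← integral_exp_eq hr.continuous hβ.continuous]
    have h1 : ∫ θ in (0 : ℝ)..2 * π, deriv c.1.toFun θ = 0 := by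
      rw [intervalIntegral.integral_deriv_eq_sub
        (fun θ _ => c.1.contDiff.differentiable (by simp) θ) (hcd.intervalIntegrable _ _)]
      simpa [sub_eq_zero] using c.1.periodic 0
    simp only [deriv_eq_velocity, velocity] at h1
    rw [intervalIntegral.integral_const_mul] at h1
    exact (mul_eq_zero.1 h1).resolve_left (Circle.coe_ne_zero _)
  refine ⟨hr, hβ, fun θ => ?_, fun θ => ?_, by simp [turningAngle],
    fun θ => norm_pos_iff.2 (c.2.1 θ), ?_, ?_⟩
  · have : Periodic (deriv c.1.toFun) (2 * π) := fun η => by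
      rw [← deriv_comp_add_const]
      congr 1
      exact funext c.1.periodic
    rw [speed, this θ, speed]
  · obtain ⟨a, ha, hper⟩ := c.2.2
    have := hper θ
    rw [turningAngle_eq ha, turningAngle_eq ha]
    push_cast at this
    linarith
  · simpa using congrArg Complex.re hclosed
  · simpa using congrArg Complex.im hclosed

/-! ### The homotopy equivalence -/

/-- The density of the standard immersion onto which `Imm 0` is deformed. -/
noncomputable def baseDensity : ℝ → ℝ :=
  posDensity (fun θ => ‖eightVelocity (collapse' θ)‖ * collapseDeriv (θ + π))
    fun θ => Complex.arg (eightVelocity (collapse' θ))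

/-- The angle function of the standard immersion onto which `Imm 0` is deformed. -/
noncomputable def baseAngle (θ : ℝ) : ℝ := Complex.arg (eightVelocity (collapse' θ))

/-- The piecewise linear function rising from `0` to `1` on the `k`-th quarter of `[0, 1]`,
counting from `0`. -/
noncomputable def ramp (k τ : ℝ) : ℝ := max 0 (min 1 (4 * τ - k))

theorem ramp_mem (k τ : ℝ) : ramp k τ ∈ Set.Icc (0 : ℝ) 1 :=
  ⟨le_max_left _ _, max_le zero_le_one (min_le_left _ _)⟩

theorem ramp_eq_zero_or_ramp_eq_one {k l : ℝ} (h : k + 1 ≤ l) (τ : ℝ) :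
    ramp l τ = 0 ∨ ramp k τ = 1 := by
  rcases le_total (4 * τ) l with hτ | hτ
  · exact .inl (max_eq_left ((min_le_right _ _).trans (by linarith)))
  · right
    rw [ramp, min_eq_left (by linarith), max_eq_right zero_le_one]

theorem continuous_ramp (k : ℝ) : Continuous (ramp k) := by
  unfold ramp; fun_prop

/-- The density at time `τ` of the deformation of a curve to a fixed one, before it is made
positive. The parameters `t`, `s`, `q`, `p` of `deformDensity` and `deformAngle` rise one after the
other: reparametrise, add the angle of the figure eight, pass to its density, forget the angle of
the initial curve. -/
noncomputable def pathDensity (x : I × Imm 0) : ℝ → ℝ :=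
  deformDensity (speed x.2) (fun θ => ‖eightVelocity θ‖) (ramp 0 x.1) (ramp 2 x.1)

/-- The angle function at time `τ` of the deformation of a curve to a fixed one. -/
noncomputable def pathAngle (x : I × Imm 0) : ℝ → ℝ :=
  deformAngle (turningAngle x.2) (fun θ => Complex.arg (eightVelocity θ)) (ramp 0 x.1) (ramp 1 x.1)
    (ramp 3 x.1)

theorem isWeakTangent_path (x : I × Imm 0) : IsWeakTangent (pathDensity x) (pathAngle x) := by
  refine isWeakTangent_deform (isTangent_speed_turningAngle x.2) isTangent_eight (ramp_mem _ _)
    (ramp_mem _ _) (ramp_eq_zero_or_ramp_eq_one (by norm_num) _) ?_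
    (ramp_eq_zero_or_ramp_eq_one (by norm_num) _).symm
  rcases ramp_eq_zero_or_ramp_eq_one (show (1 : ℝ) + 1 ≤ 2 by norm_num) x.1 with h | h
  · exact .inl h
  · rcases ramp_eq_zero_or_ramp_eq_one (show (0 : ℝ) + 1 ≤ 2 by norm_num) x.1 with h' | h'
    · exact .inl h'
    · exact .inr ⟨h, h'⟩

theorem continuous_ramp_fst (k : ℝ) : Continuous fun x : I × Imm 0 => ramp k x.1 :=
  (continuous_ramp k).comp (continuous_subtype_val.comp continuous_fst)

theorem isSmoothFamily_reparam : IsSmoothFamily fun (x : I × Imm 0) θ =>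
    (1 - ramp 0 x.1) * θ + ramp 0 x.1 * collapse θ :=
  ((IsSmoothFamily.const (continuous_const.sub (continuous_ramp_fst 0))).mul
    (.of_contDiff contDiff_id)).add
    ((IsSmoothFamily.const (continuous_ramp_fst 0)).mul (.of_contDiff isReparam_collapse.contDiff))

theorem isSmoothFamily_pathDensity : IsSmoothFamily pathDensity := by
  have h₂ := (isTangent_eight.contDiff_density.comp isReparam_collapse'.contDiff).mul
    isReparam_collapse'.contDiff_deriv
  exact ((IsSmoothFamily.const (continuous_const.sub (continuous_ramp_fst 2))).mul
    (((isSmoothFamily_speed.comp_continuous continuous_snd).reparam isSmoothFamily_reparam).mul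
      ((IsSmoothFamily.const ((continuous_const.sub (continuous_ramp_fst 0)).mul
        continuous_const)).add ((IsSmoothFamily.const (continuous_ramp_fst 0)).mul
          (.of_contDiff contDiff_collapseDeriv))))).add
    ((IsSmoothFamily.const (continuous_ramp_fst 2)).mul (.of_contDiff h₂))

theorem isSmoothFamily_pathAngle : IsSmoothFamily pathAngle :=
  ((IsSmoothFamily.const (continuous_const.sub (continuous_ramp_fst 3))).mul
    ((isSmoothFamily_turningAngle.comp_continuous continuous_snd).reparam
      isSmoothFamily_reparam)).add ((IsSmoothFamily.const (continuous_ramp_fst 1)).mul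
        (.of_contDiff (isTangent_eight.contDiff_angle.comp isReparam_collapse'.contDiff)))

theorem pathDensity_zero (c : Imm 0) : pathDensity (0, c) = speed c := by
  ext θ; simp [pathDensity, deformDensity, ramp]

theorem pathAngle_zero (c : Imm 0) : pathAngle (0, c) = turningAngle c := by
  ext θ; simp [pathAngle, deformAngle, ramp]

theorem pathAngle_one (c : Imm 0) : pathAngle (1, c) = baseAngle := by
  ext θ; norm_num [pathAngle, deformAngle, ramp, baseAngle]

theorem posDensity_path_one (c : Imm 0) :
    posDensity (pathDensity (1, c)) (pathAngle (1, c)) = baseDensity := by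
  rw [pathAngle_one, baseDensity]
  congr 1
  ext θ; norm_num [pathDensity, deformDensity, ramp]

theorem Imm.nonempty_zero : Nonempty (Imm 0) :=
  ⟨⟨loopOf 0 1 isTangent_eight, loopOf_mem_Imm _ _ _⟩⟩

theorem isTangent_base : IsTangent baseDensity baseAngle := by
  obtain ⟨c⟩ := Imm.nonempty_zero
  rw [← posDensity_path_one c, ← pathAngle_one c]
  exact (isWeakTangent_path _).isTangent_posDensity

/-- The rotations of the standard immersion. -/
noncomputable def rotatedBase : C(Circle, Imm 0) :=
  immOf (p := fun _ => 0) continuous_const continuous_id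
    (.of_contDiff isTangent_base.contDiff_density) (.of_contDiff isTangent_base.contDiff_angle)
    fun _ => isTangent_base

theorem initialDirection_loopOf (p : ℂ) (z : Circle) {r β : ℝ → ℝ} (h : IsTangent r β) :
    initialDirection ⟨loopOf p z h, loopOf_mem_Imm p z h⟩ = z := by
  apply Circle.ext
  change deriv (loopOf p z h).toFun 0 / (‖deriv (loopOf p z h).toFun 0‖ : ℂ) = z
  rw [deriv_loopOf, velocity_div_norm z 0 (h.pos 0), h.angle_zero]
  simp

/-- Move the base point to `0` and replace the speed by its canonical modification. -/
theorem homotopic_id_posDensity : (ContinuousMap.id (Imm 0)).Homotopic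
    (immOf (p := fun _ => 0) continuous_const continuous_initialDirection
      (isSmoothFamily_speed.posDensity isSmoothFamily_turningAngle) isSmoothFamily_turningAngle
      fun c => (isTangent_speed_turningAngle c).isWeakTangent.isTangent_posDensity) := by
  have hτ : Continuous fun x : I × Imm 0 => (x.1 : ℝ) := continuous_subtype_val.comp continuous_fst
  have hp : Continuous fun x : I × Imm 0 => (1 - (x.1 : ℂ)) * x.2.1.toFun 0 :=
    (continuous_const.sub (Complex.continuous_ofReal.comp hτ)).mul
      (SmoothLoop.isSmoothFamily_toFun.continuous.comp
        ((continuous_subtype_val.comp continuous_snd).prodMk continuous_const))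
  have hr : IsSmoothFamily fun (x : I × Imm 0) θ => (1 - (x.1 : ℝ)) * speed x.2 θ +
      x.1 * posDensity (speed x.2) (turningAngle x.2) θ :=
    ((IsSmoothFamily.const (continuous_const.sub hτ)).mul
      (isSmoothFamily_speed.comp_continuous continuous_snd)).add
      ((IsSmoothFamily.const hτ).mul ((isSmoothFamily_speed.posDensity
        isSmoothFamily_turningAngle).comp_continuous continuous_snd))
  refine ⟨⟨immOf hp (continuous_initialDirection.comp continuous_snd) hr
    (isSmoothFamily_turningAngle.comp_continuous continuous_snd)
    (fun x => (isTangent_speed_turningAngle x.2).convex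
      (isTangent_speed_turningAngle x.2).isWeakTangent.isTangent_posDensity x.1.2),
    fun c => ?_, fun c => ?_⟩⟩
  · refine Imm.ext_loopOf _ (by simp) fun θ => ?_
    simpa using deriv_eq_velocity c θ
  · refine Imm.ext_loopOf _ (by simp [immOf, loopOf]) fun θ => ?_
    simp [immOf, deriv_loopOf]

/-- Deform the tangent data to the standard one, making the density positive at all times. -/
theorem homotopic_posDensity_rotatedBase :
    (immOf (p := fun _ => 0) continuous_const continuous_initialDirection
      (isSmoothFamily_speed.posDensity isSmoothFamily_turningAngle) isSmoothFamily_turningAngle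
      fun c => (isTangent_speed_turningAngle c).isWeakTangent.isTangent_posDensity).Homotopic
    (rotatedBase.comp ⟨initialDirection, continuous_initialDirection⟩) := by
  refine ⟨⟨immOf (p := fun _ => 0) continuous_const
    (continuous_initialDirection.comp continuous_snd)
    (isSmoothFamily_pathDensity.posDensity isSmoothFamily_pathAngle) isSmoothFamily_pathAngle
    (fun x => (isWeakTangent_path x).isTangent_posDensity), fun c => ?_, fun c => ?_⟩⟩
  · refine Imm.ext_loopOf _ (by simp [immOf, loopOf]) fun θ => ?_
    simp [immOf, deriv_loopOf, pathDensity_zero, pathAngle_zero]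
  · refine Imm.ext_loopOf _ (by simp [rotatedBase, immOf, loopOf]) fun θ => ?_
    simp [rotatedBase, immOf, deriv_loopOf, ← posDensity_path_one c, pathAngle_one]

end PlaneCurve

theorem proposition3p1 :
    Nonempty (ContinuousMap.HomotopyEquiv (PlaneCurve.Imm 0) Circle) := by
  refine ⟨⟨⟨PlaneCurve.initialDirection, PlaneCurve.continuous_initialDirection⟩,
    PlaneCurve.rotatedBase, (PlaneCurve.homotopic_id_posDensity.trans
      PlaneCurve.homotopic_posDensity_rotatedBase).symm, ?_⟩⟩
  convert ContinuousMap.Homotopic.refl _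
  ext1 z
  exact (PlaneCurve.initialDirection_loopOf 0 z PlaneCurve.isTangent_base).symm
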